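/- For a finite group $X$ let $\mathrm{ccl}(X)$ denote the number of conjugacy classes of $X$. Let $\pi$ be a set of primes and let $\pi'$ be the complementary set of primes. A Hall $\pi$-subgroup of a finite group $X$ is a subgroup whose order has all its prime divisors in $\pi$ and whose index has all its prime divisors in $\pi'$; in a finite soluble group Hall $\pi$-subgroups exist and any two of them are conjugate. For a finite soluble group $X$ with a Hall $\pi$-subgroup $A$ and a Hall $\pi'$-subgroup $B$, say that $X$ is $\mathrm{Con}_\pi$ if $\mathrm{ccl}(X)\le \mathrm{ccl}(A)\,\mathrm{ccl}(B)$, and that $X$ is $\mathrm{Con}^*_\pi$ if either $\mathrm{ccl}(X)<\mathrm{ccl}(A)\,\mathrm{ccl}(B)$ or $X\cong A\times B$ (neither property depends on the choice of $A$ and $B$). Theorem B. Let $G$ be a finite soluble group and let $N\lhd G$ be a normal subgroup such that $G/N$ is cyclic and $(|N|,|G/N|)=1$. Suppose that every subgroup of $N$ (including $N$ itself) is $\mathrm{Con}_\pi$. Then $G$ is $\mathrm{Con}_\pi$. If in addition $N$ is $\mathrm{Con}^*_\pi$, then $G$ is $\mathrm{Con}^*_\pi$. -/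

import Mathlib

/-- `n` is a `π`-number: every prime divisor of `n` lies in the set of primes `π`. -/
def IsPiNumber (π : Set Nat.Primes) (n : ℕ) : Prop :=
  ∀ p : Nat.Primes, (p : ℕ) ∣ n → p ∈ π

/-- `H` is a Hall `π`-subgroup of the (finite) group `G`: its order is a `π`-number and its
index is a `π'`-number, where `π'` is the complement of `π` in the set of all primes. -/
def IsHallSubgroup (π : Set Nat.Primes) {G : Type*} [Group G] (H : Subgroup G) : Prop :=
  IsPiNumber π (Nat.card H) ∧ IsPiNumber πᶜ H.index

/-- `ccl G` is the number of conjugacy classes of the (finite) group `G`. -/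
noncomputable def ccl (G : Type*) [Group G] : ℕ :=
  Nat.card (ConjClasses G)

/-- A (finite soluble) group `G` is `Con_π` if `ccl G ≤ ccl A * ccl B` for Hall `π`-subgroups `A`
and Hall `π'`-subgroups `B` of `G`. In a finite soluble group such `A` and `B` exist and are unique
up to conjugacy, so that the choice of `A` and `B` does not matter. -/
def IsCon (π : Set Nat.Primes) (G : Type*) [Group G] : Prop :=
  ∀ A B : Subgroup G, IsHallSubgroup π A → IsHallSubgroup πᶜ B →
    ccl G ≤ ccl A * ccl B

/-- A (finite soluble) group `G` is `Con*_π` if `ccl G < ccl A * ccl B` or `G ≅ A × B`, for Hall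
`π`-subgroups `A` and Hall `π'`-subgroups `B` of `G`. -/
def IsConStar (π : Set Nat.Primes) (G : Type*) [Group G] : Prop :=
  ∀ A B : Subgroup G, IsHallSubgroup π A → IsHallSubgroup πᶜ B →
    ccl G < ccl A * ccl B ∨ Nonempty (G ≃* A × B)

/-! By Schur–Zassenhaus `G = NC` with `C` an abelian complement, and `C = P × Q` with `P` its
`π`-part and `Q` its `π'`-part. Choose `C`-invariant Hall subgroups `A₀`, `B₀` of `N`; then `PA₀`
and `QB₀` are Hall subgroups of `G`. Counting commuting pairs coset by coset gives `ccl G * |C| = ∑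
ccl (C_N(x, y))` over pairs in `C` (`ccl_mul_card_of_isComplement'`), and similarly for `PA₀` and
`QB₀`. As `C_N(x, y)` is a subgroup of `N` with Hall subgroups `C_{A₀}(x, y)` and `C_{B₀}(x, y)`
(`isPiNumber_relIndex_inf_centralizer`), each term is at most the product of their class numbers.
Coprime operators do not increase the class number of fixed points (`ccl_inf_centralizer_le`), so in
the `A₀` factor only the `P`-parts of `x, y` need be kept, in the `B₀` factor only the `Q`-parts.
The bounding sum then splits as a product, which is `ccl (PA₀) * ccl (QB₀) * |C|`. If equality
holds, it holds termwise. The trivial pair gives `N ≅ A₀ × B₀`; other terms make `Q` centralize `A₀`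
and `P` centralize `B₀` (`le_centralizer_of_ccl_eq`), so `G` is the direct product of `PA₀` and
`QB₀`. -/

namespace IsPiNumber

variable {π : Set Nat.Primes} {m n : ℕ}

theorem of_dvd (hn : IsPiNumber π n) (h : m ∣ n) : IsPiNumber π m :=
  fun p hp => hn p (hp.trans h)

theorem one (π : Set Nat.Primes) : IsPiNumber π 1 :=
  fun p hp => absurd (Nat.dvd_one.mp hp) p.2.one_lt.ne'

theorem mul (hm : IsPiNumber π m) (hn : IsPiNumber π n) : IsPiNumber π (m * n) :=
  fun p hp => (p.2.dvd_mul.mp hp).elim (hm p) (hn p)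

theorem mono {ρ : Set Nat.Primes} (h : π ⊆ ρ) (hn : IsPiNumber π n) : IsPiNumber ρ n :=
  fun p hp => h (hn p hp)

theorem coprime (hm : IsPiNumber π m) (hn : IsPiNumber πᶜ n) : m.Coprime n :=
  Nat.coprime_of_dvd fun p hp hpm hpn => hn ⟨p, hp⟩ hpn (hm ⟨p, hp⟩ hpm)

theorem coprime' (hm : IsPiNumber πᶜ m) (hn : IsPiNumber π n) : m.Coprime n :=
  (hn.coprime hm).symm

theorem of_coprime (h : m.Coprime n) : IsPiNumber {p : Nat.Primes | (p : ℕ) ∣ m}ᶜ n :=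
  fun p hp hpm => p.2.one_lt.ne' (Nat.eq_one_of_dvd_coprimes h hpm hp)

theorem self (m : ℕ) : IsPiNumber {p : Nat.Primes | (p : ℕ) ∣ m} m := fun _ hp => hp

end IsPiNumber

/-! ### Products of subgroups, conjugacy of complements, abelian normal subgroups. -/

namespace Subgroup

variable {G : Type*} [Group G]

theorem le_normalizer_of_forall_conj_mem {K D : Subgroup G}
    (h : ∀ d ∈ D, ∀ k ∈ K, d * k * d⁻¹ ∈ K) : D ≤ normalizer (K : Set G) := by
  intro d hd
  rw [mem_normalizer_iff]
  refine fun k => ⟨h d hd k, fun hk => ?_⟩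
  have := h d⁻¹ (inv_mem hd) _ hk
  simpa [mul_assoc] using this

theorem mem_sup_of_forall_conj_mem {K D : Subgroup G}
    (h : ∀ d ∈ D, ∀ k ∈ K, d * k * d⁻¹ ∈ K) {g : G} :
    g ∈ D ⊔ K ↔ ∃ d ∈ D, ∃ k ∈ K, d * k = g := by
  rw [← SetLike.mem_coe, coe_mul_of_left_le_normalizer_right D K
    (le_normalizer_of_forall_conj_mem h), Set.mem_mul]
  rfl

theorem relIndex_sup_of_forall_conj_mem {K D : Subgroup G}
    (h : ∀ d ∈ D, ∀ k ∈ K, d * k * d⁻¹ ∈ K) : K.relIndex (D ⊔ K) = K.relIndex D :=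
  letI := normal_subgroupOf_of_le_normalizer (le_normalizer_of_forall_conj_mem h)
  letI := normal_subgroupOf_sup_of_le_normalizer (le_normalizer_of_forall_conj_mem h)
  (Nat.card_congr (QuotientGroup.quotientInfEquivProdNormalizerQuotient D K
    (le_normalizer_of_forall_conj_mem h)).toEquiv).symm

theorem card_mul_relIndex {H K : Subgroup G} (h : H ≤ K) :
    Nat.card H * H.relIndex K = Nat.card K := by
  rw [← relIndex_bot_left, ← relIndex_bot_left]
  exact relIndex_mul_relIndex _ _ _ bot_le h

theorem card_sup_mul_card_inf {K D : Subgroup G}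
    (h : ∀ d ∈ D, ∀ k ∈ K, d * k * d⁻¹ ∈ K) :
    Nat.card (D ⊔ K : Subgroup G) * Nat.card (D ⊓ K : Subgroup G) = Nat.card D * Nat.card K := by
  rw [← card_mul_relIndex (le_sup_right : K ≤ D ⊔ K), relIndex_sup_of_forall_conj_mem h,
    ← card_mul_relIndex (inf_le_left : D ⊓ K ≤ D), inf_comm, inf_relIndex_right]
  ring

theorem card_sup_of_coprime {K D : Subgroup G} (h : ∀ d ∈ D, ∀ k ∈ K, d * k * d⁻¹ ∈ K)
    (hc : (Nat.card D).Coprime (Nat.card K)) :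
    Nat.card (D ⊔ K : Subgroup G) = Nat.card D * Nat.card K := by
  rw [← card_sup_mul_card_inf h, (disjoint_of_coprime_natCard hc).eq_bot, card_bot, mul_one]

open scoped Pointwise in
/-- Two complements of an abelian normal subgroup of coprime index are conjugate. -/
theorem exists_conj_of_isComplement' [Finite G] {M P Q : Subgroup G} [M.Normal]
    [IsMulCommutative M] (hM : (Nat.card M).Coprime M.index) (hP : IsComplement' M P)
    (hQ : IsComplement' M Q) : ∃ m ∈ M, ∀ p ∈ P, m * p * m⁻¹ ∈ Q := by
  classical
  -- Transversals of `M`, modulo trivial transfer difference: `M` acts transitively on the classes,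
  -- and each complement is the stabilizer of its own class.
  let cls (K : Subgroup G) (hK : IsComplement' M K) : M.QuotientDiff :=
    Quotient.mk'' ⟨(K : Set G), hK.symm⟩
  have stab (K : Subgroup G) (hK : IsComplement' M K) :
      K = MulAction.stabilizer G (cls K hK) := by
    have hle : K ≤ MulAction.stabilizer G (cls K hK) := by
      intro k hk
      rw [MulAction.mem_stabilizer_iff]
      refine congr_arg Quotient.mk'' ?_
      ext x
      change x ∈ MulOpposite.op k⁻¹ • (K : Set G) ↔ x ∈ K
      rw [Set.mem_smul_set_iff_inv_smul_mem]
      simp [mul_mem_cancel_right, hk]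
    have hS : IsComplement' M (MulAction.stabilizer G (cls K hK)) :=
      isComplement'_stabilizer_of_coprime hM
    refine eq_of_le_of_card_ge hle (le_of_eq ?_)
    have h1 := hS.card_mul_card.trans hK.card_mul_card.symm
    exact Nat.eq_of_mul_eq_mul_left Nat.card_pos h1
  obtain ⟨m, hm⟩ := exists_smul_eq hM (cls P hP) (cls Q hQ)
  have hm' : (m : G) • cls P hP = cls Q hQ := hm
  refine ⟨m, m.2, fun p hp => ?_⟩
  rw [stab P hP, MulAction.mem_stabilizer_iff] at hp
  rw [stab Q hQ, MulAction.mem_stabilizer_iff, ← hm', mul_smul, mul_smul, inv_smul_smul, hp]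

/-- Inside `PM = QM` both `P` and `Q` are complements of `M`. -/
theorem exists_conj_mem_of_sup_eq [Finite G] {M P Q : Subgroup G} [M.Normal]
    [IsMulCommutative M] (hP : (Nat.card M).Coprime (Nat.card P))
    (hQ : (Nat.card M).Coprime (Nat.card Q)) (h : P ⊔ M = Q ⊔ M) :
    ∃ m ∈ M, ∀ p ∈ P, m * p * m⁻¹ ∈ Q := by
  have hn (D : Subgroup G) : ∀ d ∈ D, ∀ k ∈ M, d * k * d⁻¹ ∈ M :=
    fun d _ k hk => ‹M.Normal›.conj_mem k hk d
  set X := P ⊔ M with hX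
  have hMX : M ≤ X := le_sup_right
  have key (K : Subgroup G) (hK : (Nat.card M).Coprime (Nat.card K)) (hKX : X = K ⊔ M) :
      IsComplement' (M.subgroupOf X) (K.subgroupOf X) := by
    have hle : K ≤ X := hKX ▸ le_sup_left
    refine isComplement'_of_coprime ?_ ?_
    · rw [Nat.card_congr (subgroupOfEquivOfLe hMX).toEquiv,
        Nat.card_congr (subgroupOfEquivOfLe hle).toEquiv, hKX,
        card_sup_of_coprime (hn K) hK.symm, mul_comm]
    · rwa [Nat.card_congr (subgroupOfEquivOfLe hMX).toEquiv,
        Nat.card_congr (subgroupOfEquivOfLe hle).toEquiv]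
  have hcP := key P hP hX
  have hcQ := key Q hQ h
  have hco : (Nat.card (M.subgroupOf X)).Coprime (M.subgroupOf X).index := by
    rw [hcP.symm.index_eq_card, Nat.card_congr (subgroupOfEquivOfLe hMX).toEquiv,
      Nat.card_congr (subgroupOfEquivOfLe (le_sup_left : P ≤ X)).toEquiv]
    exact hP
  have : IsMulCommutative (M.subgroupOf X) := ⟨⟨fun a b => by
    have := setLike_mul_comm (s := M) a.2 b.2
    exact Subtype.ext (Subtype.ext this)⟩⟩
  obtain ⟨m, hm, hmP⟩ := exists_conj_of_isComplement' hco hcP hcQ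
  exact ⟨m, hm, fun p hp => hmP ⟨p, (le_sup_left : P ≤ X) hp⟩ hp⟩

/-- A nontrivial finite soluble group has a nontrivial abelian normal `p`-subgroup. -/
theorem exists_normal_isMulCommutative_isPGroup [Finite G] [Group.IsSolvable G] [Nontrivial G] :
    ∃ (p : ℕ) (M : Subgroup G), p.Prime ∧ M.Normal ∧ IsMulCommutative M ∧ IsPGroup p M ∧
      M ≠ ⊥ := by
  classical
  have hex := ‹Group.IsSolvable G›.solvable
  obtain ⟨n, hn⟩ : ∃ n, Nat.find hex = n + 1 := by
    refine Nat.exists_eq_succ_of_ne_zero fun h0 => ?_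
    have := Nat.find_spec hex
    rw [h0, derivedSeries_zero] at this
    exact top_ne_bot this
  -- `L` is the last nontrivial term of the derived series, hence abelian; its elements killed by
  -- `p` form the required subgroup.
  set L := derivedSeries G n with hL
  have hL0 : L ≠ ⊥ := Nat.find_min hex (by omega)
  have hLL : ⁅L, L⁆ = ⊥ := by
    rw [← derivedSeries_succ, ← hn]
    exact Nat.find_spec hex
  have hLn : L.Normal := derivedSeries_normal G n
  have hcomm : ∀ a ∈ L, ∀ b ∈ L, a * b = b * a := fun a ha b hb => by
    have := commutator_eq_bot_iff_le_centralizer.mp hLL ha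
    exact (mem_centralizer_iff.mp this b hb).symm
  have hcard : Nat.card L ≠ 1 := fun h => hL0 (card_eq_one.mp h)
  obtain ⟨p, hp, hpd⟩ := Nat.exists_prime_and_dvd hcard
  have : Fact p.Prime := ⟨hp⟩
  obtain ⟨x, hx⟩ := exists_prime_orderOf_dvd_card' p hpd
  let M : Subgroup G :=
    { carrier := {g | g ∈ L ∧ g ^ p = 1}
      mul_mem' := fun {a b} ha hb => ⟨mul_mem ha.1 hb.1, by
        rw [Commute.mul_pow (hcomm a ha.1 b hb.1), ha.2, hb.2, one_mul]⟩
      one_mem' := ⟨one_mem _, one_pow _⟩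
      inv_mem' := fun {a} ha => ⟨inv_mem ha.1, by rw [inv_pow, ha.2, inv_one]⟩ }
  refine ⟨p, M, hp, ⟨fun a ha g => ⟨hLn.conj_mem a ha.1 g, ?_⟩⟩,
    ⟨⟨fun a b => Subtype.ext (hcomm a a.2.1 b b.2.1)⟩⟩, fun a => ⟨1, ?_⟩, fun h => ?_⟩
  · rw [conj_pow, ha.2, mul_one, mul_inv_cancel]
  · rw [pow_one]
    exact Subtype.ext a.2.2
  · have hxp : (x : G) ^ p = 1 := by
      have := pow_orderOf_eq_one x
      rw [hx] at this
      exact_mod_cast congr_arg Subtype.val this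
    have : (x : G) ∈ M := ⟨x.2, hxp⟩
    rw [h, mem_bot] at this
    have hx1 : x = 1 := Subtype.ext this
    rw [hx1, orderOf_one] at hx
    exact hp.one_lt.ne hx

theorem card_eq_card_mul_card_of_comap {M : Subgroup G} [M.Normal] (K : Subgroup (G ⧸ M)) :
    Nat.card (K.comap (QuotientGroup.mk' M)) = Nat.card M * Nat.card K := by
  have hle : M ≤ K.comap (QuotientGroup.mk' M) := fun m hm => by
    rw [mem_comap, QuotientGroup.mk'_apply, (QuotientGroup.eq_one_iff m).mpr hm]
    exact one_mem K
  rw [← card_mul_relIndex hle]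
  have := relIndex_ker (f := QuotientGroup.mk' M) (K := K.comap (QuotientGroup.mk' M))
  rw [map_comap_eq_self_of_surjective (QuotientGroup.mk'_surjective M),
    QuotientGroup.ker_mk'] at this
  rw [this]

end Subgroup

/-! ### Hall's theorem. -/

open Subgroup

/-- **Hall's theorem** for finite soluble groups: Hall `π`-subgroups exist and every `π`-subgroup is
contained, up to conjugacy, in any given one of them. -/
theorem exists_isHallSubgroup_and_dominates (π : Set Nat.Primes) (n : ℕ) :
    ∀ (G : Type*) [Group G] [Finite G] [Group.IsSolvable G], Nat.card G = n →
      (∃ H : Subgroup G, IsHallSubgroup π H) ∧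
      ∀ H P : Subgroup G, IsHallSubgroup π H → IsPiNumber π (Nat.card P) →
        ∃ g, ∀ p ∈ P, g * p * g⁻¹ ∈ H := by
  induction n using Nat.strong_induction_on with
  | _ n ih =>
  intro G _ _ _ hG
  rcases subsingleton_or_nontrivial G with hs | hs
  · refine ⟨⟨⊥, ?_, ?_⟩, fun H P _ _ => ⟨1, fun p _ => ?_⟩⟩
    · rw [card_bot]; exact IsPiNumber.one _
    · rw [index_bot, Nat.card_unique]; exact IsPiNumber.one _
    · rw [Subsingleton.elim (1 * p * 1⁻¹) 1]; exact one_mem H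
  obtain ⟨p, M, hp, hMn, hMc, hMp, hM⟩ := exists_normal_isMulCommutative_isPGroup (G := G)
  have : Fact p.Prime := ⟨hp⟩
  have hMcard : ∃ k, Nat.card M = p ^ k := hMp.exists_card_eq
  have hlt : Nat.card (G ⧸ M) < n := by
    rw [← hG, ← M.card_mul_index]
    have h1 : 1 < Nat.card M := (one_lt_card_iff_ne_bot M).mpr hM
    have h2 : 0 < M.index := Nat.pos_of_ne_zero index_ne_zero_of_finite
    change M.index < _
    nlinarith
  obtain ⟨⟨K, hK⟩, hdom⟩ := ih _ hlt (G ⧸ M) rfl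
  have hsurj := QuotientGroup.mk'_surjective M
  have hn (D : Subgroup G) : ∀ d ∈ D, ∀ k ∈ M, d * k * d⁻¹ ∈ M :=
    fun d _ k hk => hMn.conj_mem k hk d
  -- Induction in `G ⧸ M` controls conjugacy only modulo `M`.
  have hconj (H P : Subgroup G) (hH : IsHallSubgroup π H) (hP : IsPiNumber π (Nat.card P)) :
      ∃ g, ∀ p ∈ P, g * p * g⁻¹ ∈ H ⊔ M := by
    obtain ⟨g, hg⟩ := hdom (H.map (QuotientGroup.mk' M)) (P.map (QuotientGroup.mk' M))
      ⟨hH.1.of_dvd (card_map_dvd _ _), hH.2.of_dvd (index_map_dvd _ hsurj)⟩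
      (hP.of_dvd (card_map_dvd _ _))
    obtain ⟨g, rfl⟩ := hsurj g
    refine ⟨g, fun p hp => ?_⟩
    obtain ⟨h, hh, hhp⟩ := hg _ (mem_map_of_mem _ hp)
    rw [← map_mul, ← map_inv, ← map_mul] at hhp
    have hm := QuotientGroup.eq.mp hhp
    have := mul_mem (mem_sup_left (T := M) hh) (mem_sup_right (S := H) hm)
    rwa [mul_inv_cancel_left] at this
  by_cases hpπ : (⟨p, hp⟩ : Nat.Primes) ∈ π
  · have hMπ : IsPiNumber π (Nat.card M) := by
      obtain ⟨k, hk⟩ := hMcard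
      intro q hq
      rw [hk] at hq
      have : q = ⟨p, hp⟩ := Subtype.ext ((Nat.prime_dvd_prime_iff_eq q.2 hp).mp
        (q.2.dvd_of_dvd_pow hq))
      rwa [this]
    refine ⟨⟨K.comap (QuotientGroup.mk' M), ?_, ?_⟩, fun H P hH hP => ?_⟩
    · rw [card_eq_card_mul_card_of_comap]
      exact hMπ.mul hK.1
    · rw [index_comap_of_surjective _ hsurj]
      exact hK.2
    · have hle : H ⊔ M ≤ H := by
        rw [← relIndex_eq_one]
        have h1 : IsPiNumber πᶜ (H.relIndex (H ⊔ M)) :=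
          hH.2.of_dvd (relIndex_dvd_index_of_le le_sup_left)
        have h2 : IsPiNumber π (H.relIndex (H ⊔ M)) := by
          have h3 : Nat.card (H ⊔ M : Subgroup G) ∣ Nat.card H * Nat.card M :=
            ⟨_, (card_sup_mul_card_inf (hn H)).symm⟩
          rw [← card_mul_relIndex (le_sup_left : H ≤ H ⊔ M)] at h3
          exact (hH.1.mul hMπ).of_dvd ((Dvd.intro_left _ rfl).trans h3)
        exact Nat.Coprime.eq_one_of_dvd (h2.coprime h1) dvd_rfl
      obtain ⟨g, hg⟩ := hconj H P hH hP
      exact ⟨g, fun p hp => hle (hg p hp)⟩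
  · have hMπ : IsPiNumber πᶜ (Nat.card M) := by
      obtain ⟨k, hk⟩ := hMcard
      intro q hq
      rw [hk] at hq
      have : q = ⟨p, hp⟩ := Subtype.ext ((Nat.prime_dvd_prime_iff_eq q.2 hp).mp
        (q.2.dvd_of_dvd_pow hq))
      rwa [this]
    constructor
    · set Y := K.comap (QuotientGroup.mk' M) with hY
      have hMY : M ≤ Y := fun m hm => by
        rw [hY, mem_comap, QuotientGroup.mk'_apply, (QuotientGroup.eq_one_iff m).mpr hm]
        exact one_mem K
      have hYM : M.relIndex Y = Nat.card K := by
        have h1 := card_eq_card_mul_card_of_comap K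
        rw [← hY, ← card_mul_relIndex hMY] at h1
        exact Nat.eq_of_mul_eq_mul_left Nat.card_pos h1
      have hMYc : Nat.card (M.subgroupOf Y) = Nat.card M :=
        Nat.card_congr (subgroupOfEquivOfLe hMY).toEquiv
      have hco : (Nat.card (M.subgroupOf Y)).Coprime (M.subgroupOf Y).index := by
        change Nat.Coprime _ (M.relIndex Y)
        rw [hMYc, hYM]
        exact hMπ.coprime' hK.1
      obtain ⟨H, hH⟩ := exists_right_complement'_of_coprime hco
      refine ⟨H.map Y.subtype, ?_, ?_⟩
      · rw [card_map_of_injective Y.subtype_injective, ← hH.symm.index_eq_card]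
        change IsPiNumber π (M.relIndex Y)
        rw [hYM]
        exact hK.1
      · rw [← relIndex_mul_index (map_subtype_le H)]
        refine IsPiNumber.mul ?_ ?_
        · rw [relIndex, subgroupOf, comap_map_eq_self_of_injective Y.subtype_injective, hH.index_eq_card, hMYc]
          exact hMπ
        · rw [hY, index_comap_of_surjective _ hsurj]
          exact hK.2
    · intro H P hH hP
      obtain ⟨g, hg⟩ := hconj H P hH hP
      set R := P.map (MulAut.conj g).toMonoidHom with hR
      have hRle : R ≤ H ⊔ M := by
        rintro _ ⟨x, hx, rfl⟩
        exact hg x hx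
      have hRc : IsPiNumber π (Nat.card R) := hP.of_dvd (card_map_dvd _ _)
      -- By Dedekind's law `R` and `H ∩ RM` have the same product with `M`, so conjugacy of
      -- complements applies.
      have hsup : R ⊔ M = (H ⊓ (R ⊔ M)) ⊔ M := by
        refine le_antisymm (sup_le (fun r hr => ?_) le_sup_right)
          (sup_le inf_le_right le_sup_right)
        obtain ⟨h, hh, m, hm, rfl⟩ := mem_sup_of_normal_right.mp (hRle hr)
        refine mul_mem (mem_sup_left ⟨hh, ?_⟩) (mem_sup_right hm)
        have := mul_mem (mem_sup_left (T := M) hr) (mem_sup_right (S := R) (inv_mem hm))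
        rwa [mul_inv_cancel_right] at this
      obtain ⟨m, -, hm⟩ := exists_conj_mem_of_sup_eq (hMπ.coprime' hRc)
        (hMπ.coprime' (hH.1.of_dvd (card_dvd_of_le inf_le_left))) hsup
      refine ⟨m * g, fun p hp => ?_⟩
      have := (hm _ (mem_map_of_mem (MulAut.conj g).toMonoidHom hp)).1
      simpa [mul_assoc] using this

theorem Subgroup.relIndex_sup_left_of_forall_conj_mem {G : Type*} [Group G] [Finite G]
    {K D : Subgroup G} (h : ∀ d ∈ D, ∀ k ∈ K, d * k * d⁻¹ ∈ K) :
    D.relIndex (D ⊔ K) = D.relIndex K := by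
  have h1 := card_sup_mul_card_inf h
  rw [← card_mul_relIndex (le_sup_left : D ≤ D ⊔ K),
    ← card_mul_relIndex (inf_le_right : D ⊓ K ≤ K), inf_relIndex_right] at h1
  have h2 : 0 < Nat.card D * Nat.card (D ⊓ K : Subgroup G) := Nat.mul_pos Nat.card_pos Nat.card_pos
  refine Nat.eq_of_mul_eq_mul_left h2 ?_
  linarith

/-- By Burnside's lemma elements fix one coset of `H` on average; each fixes at least one, so the
identity fixes exactly one. -/
theorem Subgroup.eq_top_of_forall_exists_conj_mem {G : Type*} [Group G] [Finite G]
    {H : Subgroup G} (h : ∀ g : G, ∃ x : G, x * g * x⁻¹ ∈ H) : H = ⊤ := by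
  classical
  have := Fintype.ofFinite G
  have := Fintype.ofFinite (G ⧸ H)
  have hsum := MulAction.sum_card_fixedBy_eq_card_orbits_mul_card_group G (G ⧸ H)
  have horb : Fintype.card (Quotient (MulAction.orbitRel G (G ⧸ H))) = 1 :=
    Fintype.card_eq_one_iff.mpr ⟨Quotient.mk'' ((1 : G) : G ⧸ H), fun q =>
      Quotient.inductionOn' q fun a => Quotient.sound' (MulAction.exists_smul_eq G _ a)⟩
  rw [horb, one_mul] at hsum
  have hpos (g : G) : 1 ≤ Fintype.card (MulAction.fixedBy (G ⧸ H) g) := by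
    obtain ⟨x, hx⟩ := h g
    refine Fintype.card_pos_iff.mpr ⟨⟨((x⁻¹ : G) : G ⧸ H), ?_⟩⟩
    rw [MulAction.mem_fixedBy, MulAction.Quotient.smul_coe, eq_comm, QuotientGroup.eq]
    simpa [mul_assoc] using hx
  have hone : Fintype.card (MulAction.fixedBy (G ⧸ H) (1 : G)) = 1 := by
    by_contra hne
    have hlt : ∑ _g : G, 1 < ∑ g : G, Fintype.card (MulAction.fixedBy (G ⧸ H) g) :=
      Finset.sum_lt_sum (fun g _ => hpos g)
        ⟨1, Finset.mem_univ _, lt_of_le_of_ne (hpos 1) (Ne.symm hne)⟩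
    rw [hsum] at hlt
    simp at hlt
  rw [← index_eq_one, index_eq_card, Nat.card_eq_fintype_card, ← hone]
  exact (Fintype.card_congr (Equiv.subtypeUnivEquiv fun a => one_smul G a)).symm

/-! ### Coprime action: invariant Hall subgroups, fixed points and their classes. -/

section Hall

variable {G : Type*} [Group G] [Finite G] [Group.IsSolvable G] {π : Set Nat.Primes}

theorem exists_le_isPiNumber_relIndex (π : Set Nat.Primes) (X : Subgroup G) :
    ∃ H ≤ X, IsPiNumber π (Nat.card H) ∧ IsPiNumber πᶜ (H.relIndex X) := by
  obtain ⟨H, hH, hHi⟩ := (exists_isHallSubgroup_and_dominates π _ X rfl).1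
  refine ⟨H.map X.subtype, map_subtype_le H, ?_, ?_⟩
  · rwa [card_map_of_injective X.subtype_injective]
  · rwa [relIndex, subgroupOf, comap_map_eq_self_of_injective X.subtype_injective]

theorem exists_conj_mem_of_isPiNumber {X H P : Subgroup G} (hHX : H ≤ X) (hPX : P ≤ X)
    (hH : IsPiNumber π (Nat.card H)) (hi : IsPiNumber πᶜ (H.relIndex X))
    (hP : IsPiNumber π (Nat.card P)) : ∃ g ∈ X, ∀ p ∈ P, g * p * g⁻¹ ∈ H := by
  obtain ⟨g, hg⟩ := (exists_isHallSubgroup_and_dominates π _ X rfl).2 (H.subgroupOf X)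
    (P.subgroupOf X) ⟨by rwa [Nat.card_congr (subgroupOfEquivOfLe hHX).toEquiv], hi⟩
    (by rwa [Nat.card_congr (subgroupOfEquivOfLe hPX).toEquiv])
  exact ⟨g, g.2, fun p hp => hg ⟨p, hPX hp⟩ hp⟩

/-- `H` is a Hall subgroup for the primes dividing its own order. Used to carry conjugates of an
operator group back to it. -/
theorem exists_conj_mem_of_coprime {X H P : Subgroup G} (hHX : H ≤ X) (hPX : P ≤ X)
    (hH : (Nat.card H).Coprime (H.relIndex X)) (hP : Nat.card P ∣ Nat.card H) :
    ∃ g ∈ X, ∀ p ∈ P, g * p * g⁻¹ ∈ H :=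
  exists_conj_mem_of_isPiNumber hHX hPX (IsPiNumber.self _) (IsPiNumber.of_coprime hH)
    ((IsPiNumber.self _).of_dvd hP)

/-- A group acting coprimely by conjugation on a normal complement leaves some Hall subgroup
invariant. -/
theorem exists_invariant_isPiNumber_relIndex (π : Set Nat.Primes) {N C : Subgroup G} [N.Normal]
    (hcop : (Nat.card C).Coprime (Nat.card N)) :
    ∃ A ≤ N, IsPiNumber π (Nat.card A) ∧ IsPiNumber πᶜ (A.relIndex N) ∧
      ∀ c ∈ C, ∀ a ∈ A, c * a * c⁻¹ ∈ A := by
  set σ : Set Nat.Primes := {p | (p : ℕ) ∣ Nat.card C} with hσ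
  have hN : IsPiNumber σᶜ (Nat.card N) := IsPiNumber.of_coprime hcop
  -- Some conjugate `H'` of a Hall `(π ∪ σ)`-subgroup contains `C`, so `C` normalizes `H' ∩ N`; no
  -- prime of `σ` divides `|N|`.
  obtain ⟨⟨H, hH, hHi⟩, hdom⟩ := exists_isHallSubgroup_and_dominates (π ∪ σ) _ G rfl
  obtain ⟨g, hg⟩ := hdom H C ⟨hH, hHi⟩ ((IsPiNumber.self _).mono Set.subset_union_right)
  set H' := H.comap (MulAut.conj g).toMonoidHom with hH'
  refine ⟨H' ⊓ N, inf_le_right, ?_, ?_, ?_⟩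
  · intro p hp
    have h1 : p ∈ π ∪ σ := hH p (hp.trans ((card_dvd_of_le inf_le_left).trans
      (card_comap_dvd_of_injective H _ (MulAut.conj g).injective)))
    exact h1.resolve_right (hN p (hp.trans (card_dvd_of_le inf_le_right)))
  · rw [inf_relIndex_right, ← relIndex_sup_left_of_forall_conj_mem
      fun d _ k hk => ‹N.Normal›.conj_mem k hk d]
    refine (hHi.mono (Set.compl_subset_compl.mpr Set.subset_union_left)).of_dvd ?_
    rw [← index_comap_of_surjective H (f := (MulAut.conj g).toMonoidHom) (MulAut.conj g).surjective]
    exact relIndex_dvd_index_of_le le_sup_left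
  · intro c hc a ha
    have hc' : c ∈ H' := hg c hc
    exact mem_inf.mpr ⟨mul_mem (mul_mem hc' ha.1) (inv_mem hc'), ‹N.Normal›.conj_mem a ha.2 c⟩

/-- The fixed points of a coprime group of operators in an invariant Hall subgroup form a Hall
subgroup of the fixed points. -/
theorem isPiNumber_relIndex_inf_centralizer {N A D : Subgroup G} (hAN : A ≤ N)
    (hDN : ∀ d ∈ D, ∀ n ∈ N, d * n * d⁻¹ ∈ N) (hDA : ∀ d ∈ D, ∀ a ∈ A, d * a * d⁻¹ ∈ A)
    (hcop : (Nat.card D).Coprime (Nat.card N)) (hA : IsPiNumber π (Nat.card A))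
    (hi : IsPiNumber πᶜ (A.relIndex N)) :
    IsPiNumber πᶜ ((A ⊓ centralizer (D : Set G)).relIndex (N ⊓ centralizer (D : Set G))) := by
  set E := N ⊓ centralizer (D : Set G) with hE
  set σ : Set Nat.Primes := {p | (p : ℕ) ∣ Nat.card D} with hσ
  have hD : IsPiNumber σ (Nat.card D) := IsPiNumber.self _
  have hN : IsPiNumber σᶜ (Nat.card N) := IsPiNumber.of_coprime hcop
  have hcopA : (Nat.card D).Coprime (Nat.card A) := hcop.coprime_dvd_right (card_dvd_of_le hAN)
  obtain ⟨P, hPE, hP, hPi⟩ := exists_le_isPiNumber_relIndex π E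
  have hPD : ∀ d ∈ D, ∀ p ∈ P, d * p * d⁻¹ ∈ P := fun d hd p hp => by
    rw [mem_centralizer_iff.mp (hPE hp).2 d hd, mul_inv_cancel_right]
    exact hp
  have hcopP : (Nat.card D).Coprime (Nat.card P) :=
    hcop.coprime_dvd_right (card_dvd_of_le (hPE.trans inf_le_left))
  have hDAN : D ⊔ A ≤ D ⊔ N := sup_le_sup_left hAN D
  have hidx : (D ⊔ A).relIndex (D ⊔ N) = A.relIndex N := by
    have h1 := card_mul_relIndex hDAN
    rw [card_sup_of_coprime hDA hcopA, card_sup_of_coprime hDN hcop, ← card_mul_relIndex hAN,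
      mul_assoc] at h1
    exact Nat.eq_of_mul_eq_mul_left Nat.card_pos (Nat.eq_of_mul_eq_mul_left Nat.card_pos h1)
  -- `DA` is a Hall `(π ∪ σ)`-subgroup of `DN`, so it contains a conjugate of `DP`. A further
  -- conjugation within `DA` returns `D` to itself, so `k = hg` normalizes `D` and carries `P` into
  -- the fixed points of `A`.
  obtain ⟨g, hg, hgP⟩ := exists_conj_mem_of_isPiNumber (π := π ∪ σ) (X := D ⊔ N) (H := D ⊔ A)
    (P := D ⊔ P) hDAN (sup_le_sup_left (hPE.trans inf_le_left) D)
    (by rw [card_sup_of_coprime hDA hcopA]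
        exact (hD.mono Set.subset_union_right).mul (hA.mono Set.subset_union_left))
    (by rw [hidx, Set.compl_union]
        exact fun p hp => ⟨hi p hp, hN p (hp.trans (relIndex_dvd_card _ _))⟩)
    (by rw [card_sup_of_coprime hPD hcopP]
        exact (hD.mono Set.subset_union_right).mul (hP.mono Set.subset_union_left))
  obtain ⟨h, hh, hhD⟩ := exists_conj_mem_of_coprime (X := D ⊔ A) (H := D)
    (P := D.map (MulAut.conj g).toMonoidHom) le_sup_left
    (by rintro _ ⟨d, hd, rfl⟩
        exact hgP d (mem_sup_left hd))
    (by rw [relIndex_sup_left_of_forall_conj_mem hDA]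
        exact hcopA.coprime_dvd_right (relIndex_dvd_card _ _))
    (card_map_dvd _ _)
  set k := h * g with hk
  have hkD : ∀ d ∈ D, k * d * k⁻¹ ∈ D := fun d hd => by
    have := hhD _ (mem_map_of_mem (MulAut.conj g).toMonoidHom hd)
    simpa [hk, mul_assoc] using this
  have hkDs : ∀ d ∈ D, k⁻¹ * d * k ∈ D := by
    have h1 : D.map (MulAut.conj k).toMonoidHom = D := by
      refine eq_of_le_of_card_ge ?_ ?_
      · rintro _ ⟨d, hd, rfl⟩
        exact hkD d hd
      · rw [card_map_of_injective (MulAut.conj k).injective]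
    intro d hd
    rw [← h1] at hd
    obtain ⟨d', hd', rfl⟩ := hd
    simpa [mul_assoc] using hd'
  have hkX : k ∈ D ⊔ N := mul_mem (hDAN hh) hg
  have hkP : P.map (MulAut.conj k).toMonoidHom ≤ A ⊓ centralizer (D : Set G) := by
    rintro _ ⟨p, hp, rfl⟩
    change k * p * k⁻¹ ∈ _
    have hpN : k * p * k⁻¹ ∈ N := by
      obtain ⟨d, hd, n, hn, hdn⟩ := (mem_sup_of_forall_conj_mem hDN).mp hkX
      have := hDN d hd _ (mul_mem (mul_mem hn (hPE hp).1) (inv_mem hn))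
      rw [← hdn]
      simpa [mul_assoc] using this
    have hpX : k * p * k⁻¹ ∈ D ⊔ A := by
      have := mul_mem (mul_mem hh (hgP p (mem_sup_right hp))) (inv_mem hh)
      simpa [hk, mul_assoc] using this
    refine mem_inf.mpr ⟨?_, ?_⟩
    · obtain ⟨d, hd, a, ha, hda⟩ := (mem_sup_of_forall_conj_mem hDA).mp hpX
      have hdN : d ∈ D ⊓ N := by
        refine ⟨hd, ?_⟩
        rw [← hda] at hpN
        exact (mul_mem_cancel_right (hAN ha)).mp hpN
      rw [(disjoint_of_coprime_natCard hcop).eq_bot, mem_bot] at hdN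
      rw [← hda, hdN, one_mul]
      exact ha
    · rw [mem_centralizer_iff]
      intro d hd
      have := mem_centralizer_iff.mp (hPE hp).2 _ (hkDs d hd)
      calc d * (k * p * k⁻¹) = k * ((k⁻¹ * d * k) * p) * k⁻¹ := by group
        _ = k * (p * (k⁻¹ * d * k)) * k⁻¹ := by rw [this]
        _ = k * p * k⁻¹ * d := by group
  refine hPi.of_dvd ?_
  have h1 := card_mul_relIndex (inf_le_inf_right (centralizer (D : Set G)) hAN)
  rw [← card_mul_relIndex hPE] at h1
  obtain ⟨m, hm⟩ := card_dvd_of_le hkP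
  rw [card_map_of_injective (MulAut.conj k).injective] at hm
  rw [hm, mul_assoc] at h1
  exact ⟨m, by rw [← Nat.eq_of_mul_eq_mul_left Nat.card_pos h1, mul_comm]⟩

/-- `D` and `kDk⁻¹` both lie in `DK ∩ C(v)`, where `v = kuk⁻¹`, so some `x` there conjugates the
second onto the first. Writing `xk = dc`, the factor `c` normalizes `D`, hence centralizes it as `D
∩ K = 1`; and `x`, `d` commute with `v`. -/
theorem exists_conj_mem_inf_centralizer {K D : Subgroup G}
    (hDK : ∀ d ∈ D, ∀ k ∈ K, d * k * d⁻¹ ∈ K) (hcop : (Nat.card D).Coprime (Nat.card K))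
    {u k : G} (hu : u ∈ centralizer (D : Set G)) (hk : k ∈ K)
    (hku : k * u * k⁻¹ ∈ centralizer (D : Set G)) :
    ∃ c ∈ K ⊓ centralizer (D : Set G), c * u * c⁻¹ = k * u * k⁻¹ := by
  set v := k * u * k⁻¹ with hv
  have hDv : D ≤ centralizer {v} := fun d hd => by
    rw [mem_centralizer_singleton_iff]
    exact mem_centralizer_iff.mp hku d hd
  have hDX : D ≤ (D ⊔ K) ⊓ centralizer {v} := le_inf le_sup_left hDv
  obtain ⟨x, hx, hxD⟩ := exists_conj_mem_of_coprime (X := (D ⊔ K) ⊓ centralizer {v}) (H := D)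
    (P := D.map (MulAut.conj k).toMonoidHom) hDX
    (by rintro _ ⟨d, hd, rfl⟩
        refine mem_inf.mpr ⟨?_, ?_⟩
        · exact mul_mem (mul_mem (mem_sup_right hk) (mem_sup_left hd))
            (inv_mem (mem_sup_right hk))
        · change k * d * k⁻¹ ∈ centralizer {v}
          rw [mem_centralizer_singleton_iff, hv]
          have := mem_centralizer_iff.mp hu d hd
          calc k * d * k⁻¹ * (k * u * k⁻¹) = k * (d * u) * k⁻¹ := by group
            _ = k * (u * d) * k⁻¹ := by rw [this]
            _ = _ := by group)
    (by refine hcop.coprime_dvd_right ?_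
        exact ((Dvd.intro _ (relIndex_mul_relIndex D _ (D ⊔ K) hDX inf_le_left)).trans
          (relIndex_sup_left_of_forall_conj_mem hDK).dvd).trans (relIndex_dvd_card _ _))
    (card_map_dvd _ _)
  obtain ⟨d, hd, c, hc, hdc⟩ := (mem_sup_of_forall_conj_mem hDK).mp
    (mul_mem hx.1 (mem_sup_right (S := D) hk))
  have hcD : ∀ e ∈ D, c * e * c⁻¹ ∈ D := fun e he => by
    have h1 := hxD _ (mem_map_of_mem (MulAut.conj k).toMonoidHom he)
    have h2 : x * k * e * (x * k)⁻¹ ∈ D := by simpa [mul_assoc] using h1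
    rw [← hdc] at h2
    have h3 := mul_mem (mul_mem (inv_mem hd) h2) hd
    simpa [mul_assoc] using h3
  have hcC : c ∈ centralizer (D : Set G) := by
    rw [mem_centralizer_iff]
    intro e he
    have h1 : c * e * c⁻¹ * e⁻¹ ∈ D ⊓ K := by
      refine mem_inf.mpr ⟨mul_mem (hcD e he) (inv_mem he), ?_⟩
      have := mul_mem hc (hDK e he _ (inv_mem hc))
      simpa [mul_assoc] using this
    rw [(disjoint_of_coprime_natCard hcop).eq_bot, mem_bot, mul_inv_eq_one,
      mul_inv_eq_iff_eq_mul] at h1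
    exact h1.symm
  refine ⟨c, ⟨hc, hcC⟩, ?_⟩
  have h1 : x * v = v * x := mem_centralizer_singleton_iff.mp hx.2
  have h2 : d * v = v * d := mem_centralizer_iff.mp hku d hd
  have h3 : c = d⁻¹ * (x * k) := by rw [← hdc, inv_mul_cancel_left]
  calc c * u * c⁻¹ = d⁻¹ * (x * v) * x⁻¹ * d := by rw [h3, hv]; group
    _ = d⁻¹ * (v * d) := by rw [h1]; group
    _ = v := by rw [← h2]; group

theorem map_inclusion_inf_centralizer_injective {K D : Subgroup G}
    (hDK : ∀ d ∈ D, ∀ k ∈ K, d * k * d⁻¹ ∈ K) (hcop : (Nat.card D).Coprime (Nat.card K)) :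
    Function.Injective (ConjClasses.map
      (inclusion (inf_le_left : K ⊓ centralizer (D : Set G) ≤ K))) := by
  intro a b
  obtain ⟨a, rfl⟩ := ConjClasses.mk_surjective a
  obtain ⟨b, rfl⟩ := ConjClasses.mk_surjective b
  intro hab
  obtain ⟨k, hk⟩ := isConj_iff.mp (ConjClasses.mk_eq_mk_iff_isConj.mp hab)
  have hk' : (k : G) * a * (k : G)⁻¹ = b := congr_arg Subtype.val hk
  obtain ⟨c, hc, hcu⟩ := exists_conj_mem_inf_centralizer hDK hcop a.2.2 k.2
    (by rw [hk']; exact b.2.2)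
  exact ConjClasses.mk_eq_mk_iff_isConj.mpr
    (isConj_iff.mpr ⟨⟨c, hc⟩, Subtype.ext (hcu.trans hk')⟩)

theorem ccl_inf_centralizer_le {K D : Subgroup G}
    (hDK : ∀ d ∈ D, ∀ k ∈ K, d * k * d⁻¹ ∈ K) (hcop : (Nat.card D).Coprime (Nat.card K)) :
    ccl (K ⊓ centralizer (D : Set G) : Subgroup G) ≤ ccl K :=
  Nat.card_le_card_of_injective _ (map_inclusion_inf_centralizer_injective hDK hcop)

/-- Equality makes the injection on classes bijective, so every element of `K` is conjugate to a
fixed point, and the conjugates of a proper subgroup never cover a finite group. -/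
theorem le_centralizer_of_ccl_eq {K D : Subgroup G}
    (hDK : ∀ d ∈ D, ∀ k ∈ K, d * k * d⁻¹ ∈ K) (hcop : (Nat.card D).Coprime (Nat.card K))
    (h : ccl (K ⊓ centralizer (D : Set G) : Subgroup G) = ccl K) :
    K ≤ centralizer (D : Set G) := by
  have hbij := (Nat.bijective_iff_injective_and_card _).mpr
    ⟨map_inclusion_inf_centralizer_injective hDK hcop, h⟩
  have htop : (centralizer (D : Set G)).subgroupOf K = ⊤ := by
    refine eq_top_of_forall_exists_conj_mem fun g => ?_
    obtain ⟨a, ha⟩ := hbij.2 (ConjClasses.mk g)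
    obtain ⟨a, rfl⟩ := ConjClasses.mk_surjective a
    obtain ⟨x, hx⟩ := isConj_iff.mp (ConjClasses.mk_eq_mk_iff_isConj.mp ha).symm
    refine ⟨x, ?_⟩
    rw [hx]
    exact a.2.2
  exact subgroupOf_eq_top.mp htop

end Hall

/-! ### Counting classes and fibres. -/

theorem ccl_congr {G H : Type*} [Group G] [Group H] (e : G ≃* H) : ccl G = ccl H :=
  Nat.card_congr
    { toFun := ConjClasses.map e.toMonoidHom
      invFun := ConjClasses.map e.symm.toMonoidHom
      left_inv := fun a => by
        obtain ⟨a, rfl⟩ := ConjClasses.mk_surjective a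
        exact congr_arg ConjClasses.mk (e.symm_apply_apply a)
      right_inv := fun a => by
        obtain ⟨a, rfl⟩ := ConjClasses.mk_surjective a
        exact congr_arg ConjClasses.mk (e.apply_symm_apply a) }

theorem ccl_pos (G : Type*) [Group G] [Finite G] : 0 < ccl G := by
  have : Finite (ConjClasses G) := Finite.of_surjective _ ConjClasses.mk_surjective
  exact Nat.card_pos

theorem Nat.card_eq_mul_card_of_card_fiber {α β : Type*} [Finite α] [Finite β] (f : α → β) (k : ℕ)
    (h : ∀ b, Nat.card {a // f a = b} = k) : Nat.card α = k * Nat.card β := by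
  have := Fintype.ofFinite β
  rw [← Nat.card_congr (Equiv.sigmaFiberEquiv f), Nat.card_sigma, Finset.sum_congr rfl fun b _ => h b,
    Finset.sum_const, Finset.card_univ, smul_eq_mul, Nat.card_eq_fintype_card, mul_comm]

theorem Subgroup.mem_centralizer_pair_iff {G : Type*} [Group G] {x y g : G} :
    g ∈ centralizer ({x, y} : Set G) ↔ x * g = g * x ∧ y * g = g * y := by
  simp [mem_centralizer_iff]

/-! ### Class number of a coprime split extension. -/

section Count

variable {G : Type*} [Group G]

/-- Conjugate elements with prescribed parts of coprime orders have conjugate parts. -/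
theorem conj_eq_and_conj_eq_of_conj_mul_eq {r : ℕ} {x u u' k : G} (hx : x ^ r = x)
    (hu : u ^ r = 1) (hu' : u' ^ r = 1) (hxu : Commute x u) (hxu' : Commute x u')
    (h : k * (x * u) * k⁻¹ = x * u') : k * x * k⁻¹ = x ∧ k * u * k⁻¹ = u' := by
  have h1 : k * x * k⁻¹ = x := by
    have := congr_arg (· ^ r) h
    simpa only [conj_pow, hxu.mul_pow, hxu'.mul_pow, hx, hu, hu', mul_one] using this
  refine ⟨h1, ?_⟩
  have h2 : k * x * k⁻¹ * (k * u * k⁻¹) = x * u' := by rw [← h]; group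
  rw [h1] at h2
  exact mul_left_cancel h2

/-- Lets Hall's theorem move two commuting elements into the complement simultaneously. -/
theorem IsPiNumber.card_zpowers_sup {a b : G} (hab : Commute a b) {m : ℕ} (ha : a ^ m = 1)
    (hb : b ^ m = 1) :
    IsPiNumber {p : Nat.Primes | (p : ℕ) ∣ m} (Nat.card (zpowers a ⊔ zpowers b : Subgroup G)) := by
  have h : ∀ d ∈ zpowers a, ∀ k ∈ zpowers b, d * k * d⁻¹ ∈ zpowers b := by
    rintro _ ⟨i, rfl⟩ _ ⟨j, rfl⟩
    have := ((hab.zpow_left i).zpow_right j).eq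
    simp only [this, mul_inv_cancel_right]
    exact ⟨j, rfl⟩
  have hd : Nat.card (zpowers a ⊔ zpowers b : Subgroup G) ∣ orderOf a * orderOf b := by
    rw [← Nat.card_zpowers, ← Nat.card_zpowers, ← card_sup_mul_card_inf h]
    exact Dvd.intro _ rfl
  exact (((IsPiNumber.self m).of_dvd (orderOf_dvd_of_pow_eq_one ha)).mul
    ((IsPiNumber.self m).of_dvd (orderOf_dvd_of_pow_eq_one hb))).of_dvd hd

variable [Finite G] [Group.IsSolvable G] {N C : Subgroup G}

/-- Every such pair is `N`-conjugate to some `(xu, yv)` with `u, v` commuting in `E = C_N(x, y)`.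
The resulting parametrization `F` has fibres of size `|E|`, and `E` has `|E| * ccl E` commuting
pairs. -/
theorem card_commute_coset [N.Normal] (hNC : IsComplement' N C) (hcop : (Nat.card C).Coprime (Nat.card N))
    (hC : ∀ a ∈ C, ∀ b ∈ C, a * b = b * a) {x y : G} (hx : x ∈ C) (hy : y ∈ C) :
    Nat.card {p : G × G // Commute p.1 p.2 ∧ (p.1 : G ⧸ N) = x ∧ (p.2 : G ⧸ N) = y} =
      Nat.card N * ccl (N ⊓ centralizer ({x, y} : Set G) : Subgroup G) := by
  -- With `r ≡ 1` mod `|C|` and `r ≡ 0` mod `|N|`, the `r`-th power fixes `C` pointwise, kills `N`,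
  -- and sends any element to one of order dividing `|C|`.
  obtain ⟨r, hrC, hrN⟩ := Nat.chineseRemainder hcop 1 0
  have hrC' : ∀ c ∈ C, c ^ r = c := fun c hc => by
    have h1 : c ^ Nat.card C = 1 := by
      have := pow_card_eq_one' (x := (⟨c, hc⟩ : C))
      exact congr_arg Subtype.val this
    have h2 := pow_eq_pow_iff_modEq.mpr (hrC.of_dvd (orderOf_dvd_of_pow_eq_one h1))
    rwa [pow_one] at h2
  have hrN' : ∀ n ∈ N, n ^ r = 1 := fun n hn => by
    have h1 : n ^ Nat.card N = 1 := by
      have := pow_card_eq_one' (x := (⟨n, hn⟩ : N))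
      exact congr_arg Subtype.val this
    have h2 := pow_eq_pow_iff_modEq.mpr (hrN.of_dvd (orderOf_dvd_of_pow_eq_one h1))
    rwa [pow_zero] at h2
  have hrG : ∀ g : G, (g ^ r) ^ Nat.card C = 1 := fun g => by
    rw [← pow_mul]
    refine orderOf_dvd_iff_pow_eq_one.mp ((orderOf_dvd_natCard g).trans ?_)
    rw [← hNC.card_mul_card]
    exact mul_dvd_mul_right ((Nat.modEq_zero_iff_dvd).mp hrN) _
  have hdec : ∀ k : G, ∃ c ∈ C, ∃ n ∈ N, c * n = k := fun k => by
    obtain ⟨⟨c, n⟩, h⟩ := hNC.symm.2 k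
    exact ⟨c, c.2, n, n.2, h⟩
  have hinj : ∀ a ∈ C, ∀ b ∈ C, (a : G ⧸ N) = b → a = b := fun a ha b hb hab => by
    have h1 : a⁻¹ * b ∈ N ⊓ C := mem_inf.mpr ⟨QuotientGroup.eq.mp hab, mul_mem (inv_mem ha) hb⟩
    rw [hNC.disjoint.eq_bot, mem_bot, inv_mul_eq_one] at h1
    exact h1
  have hmk : ∀ k : G, ∀ c ∈ C, ((k * c * k⁻¹ : G) : G ⧸ N) = c := fun k c hc => by
    obtain ⟨d, hd, n, hn, rfl⟩ := hdec k
    rw [QuotientGroup.mk_mul, QuotientGroup.mk_mul, QuotientGroup.mk_inv, QuotientGroup.mk_mul,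
      (QuotientGroup.eq_one_iff n).mpr hn, mul_one, ← QuotientGroup.mk_mul, hC d hd c hc,
      QuotientGroup.mk_mul, mul_inv_cancel_right]
  set E := N ⊓ centralizer ({x, y} : Set G) with hE
  have hEx : ∀ e ∈ E, x * e = e * x := fun e he => (mem_centralizer_pair_iff.mp he.2).1
  have hEy : ∀ e ∈ E, y * e = e * y := fun e he => (mem_centralizer_pair_iff.mp he.2).2
  have hcoset : ∀ n ∈ N, ∀ z : G, ∀ e ∈ E, ((n * (z * e) * n⁻¹ : G) : G ⧸ N) = z := by
    intro n hn z e he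
    simp only [QuotientGroup.mk_mul, QuotientGroup.mk_inv, (QuotientGroup.eq_one_iff n).mpr hn,
      (QuotientGroup.eq_one_iff e).mpr he.1, one_mul, mul_one, inv_one]
  let F : N × {p : E × E // Commute p.1 p.2} →
      {p : G × G // Commute p.1 p.2 ∧ (p.1 : G ⧸ N) = x ∧ (p.2 : G ⧸ N) = y} := fun q =>
    ⟨(q.1 * (x * q.2.1.1) * (q.1 : G)⁻¹, q.1 * (y * q.2.1.2) * (q.1 : G)⁻¹), by
      have h1 : Commute (x * q.2.1.1 : G) (y * q.2.1.2) :=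
        Commute.mul_left (Commute.mul_right (hC x hx y hy) (hEx _ q.2.1.2.2))
          (Commute.mul_right (hEy _ q.2.1.1.2).symm (congr_arg Subtype.val q.2.2.eq))
      exact (Commute.conj_iff _).mpr h1,
      hcoset _ q.1.2 x _ q.2.1.1.2, hcoset _ q.1.2 y _ q.2.1.2.2⟩
  have hF : ∀ s, ∃ q, F q = s := by
    rintro ⟨⟨g, h⟩, hgh, hgx, hhy⟩
    have hgx : (g : G ⧸ N) = x := hgx
    have hhy : (h : G ⧸ N) = y := hhy
    have hgh : Commute g h := hgh
    obtain ⟨k, -, hk⟩ := exists_conj_mem_of_isPiNumber (X := ⊤) (H := C)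
      (P := zpowers (g ^ r) ⊔ zpowers (h ^ r)) le_top le_top (IsPiNumber.self (Nat.card C))
      (by rw [relIndex_top_right, hNC.symm.symm.index_eq_card]
          exact IsPiNumber.of_coprime hcop)
      (IsPiNumber.card_zpowers_sup (hgh.pow_pow r r) (hrG g) (hrG h))
    -- As `C` is abelian, conjugation preserves the coset of an element of `C`, so the parts of `g`
    -- and `h` land exactly on `x` and `y`.
    have hpart : ∀ g z : G, z ∈ C → (g : G ⧸ N) = z → k * g ^ r * k⁻¹ ∈ C →
        k * g ^ r * k⁻¹ = z := fun g z hz hgz hkg => by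
      refine hinj _ hkg z hz ?_
      rw [QuotientGroup.mk_mul, QuotientGroup.mk_mul, QuotientGroup.mk_pow, hgz,
        ← QuotientGroup.mk_pow, hrC' z hz, ← QuotientGroup.mk_mul, ← QuotientGroup.mk_mul, hmk k z hz]
    have hkg := hpart g x hx hgx (hk _ (mem_sup_left (mem_zpowers _)))
    have hkh := hpart h y hy hhy (hk _ (mem_sup_right (mem_zpowers _)))
    obtain ⟨c, hc, n, hn, rfl⟩ := hdec k
    have hstrip : ∀ g z : G, z ∈ C → c * n * g ^ r * (c * n)⁻¹ = z → (n * g * n⁻¹) ^ r = z := by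
      intro g z hz h
      have h1 : c * (n * g ^ r * n⁻¹) * c⁻¹ = z := by rw [← h]; group
      rw [conj_pow, ← mul_right_inj c, hC c hc z hz, ← h1]
      group
    have hng := hstrip g x hx hkg
    have hnh := hstrip h y hy hkh
    have hcomm : Commute (n * g * n⁻¹) (n * h * n⁻¹) := (Commute.conj_iff _).mpr hgh
    set g' := n * g * n⁻¹ with hg'
    set h' := n * h * n⁻¹ with hh'
    have hxg : Commute x g' := by rw [← hng]; exact Commute.pow_self g' r
    have hxh : Commute x h' := by rw [← hng]; exact hcomm.pow_left r
    have hyg : Commute y g' := by rw [← hnh]; exact hcomm.symm.pow_left r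
    have hyh : Commute y h' := by rw [← hnh]; exact Commute.pow_self h' r
    have hxy : Commute x y := hC x hx y hy
    have hmem : ∀ g z : G, (g : G ⧸ N) = z → z⁻¹ * (n * g * n⁻¹) ∈ N := fun g z hgz => by
      rw [← QuotientGroup.eq_one_iff]
      simp only [QuotientGroup.mk_mul, QuotientGroup.mk_inv, (QuotientGroup.eq_one_iff n).mpr hn,
        one_mul, inv_one, mul_one, hgz, inv_mul_cancel]
    have hu : x⁻¹ * g' ∈ E := ⟨hmem g x hgx, mem_centralizer_pair_iff.mpr
      ⟨((Commute.refl x).inv_right.mul_right hxg).eq, (hxy.symm.inv_right.mul_right hyg).eq⟩⟩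
    have hv : y⁻¹ * h' ∈ E := ⟨hmem h y hhy, mem_centralizer_pair_iff.mpr
      ⟨(hxy.inv_right.mul_right hxh).eq, ((Commute.refl y).inv_right.mul_right hyh).eq⟩⟩
    have huv : Commute (x⁻¹ * g') (y⁻¹ * h') :=
      (hxy.inv_inv.mul_right hxh.inv_left).mul_left (hyg.symm.inv_right.mul_right hcomm)
    refine ⟨(⟨n⁻¹, inv_mem hn⟩, ⟨(⟨_, hu⟩, ⟨_, hv⟩), Subtype.ext huv⟩), Subtype.ext ?_⟩
    refine Prod.ext ?_ ?_
    · change n⁻¹ * (x * (x⁻¹ * g')) * n⁻¹⁻¹ = g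
      rw [hg']; group
    · change n⁻¹ * (y * (y⁻¹ * h')) * n⁻¹⁻¹ = h
      rw [hh']; group
  have hfib : ∀ s, Nat.card {q // F q = s} = Nat.card E := by
    intro s
    obtain ⟨⟨n, ⟨⟨u, v⟩, huv⟩⟩, rfl⟩ := hF s
    have hconj : ∀ z e w : G, z * e = e * z →
        n * e⁻¹ * (z * (e * w * e⁻¹)) * (n * e⁻¹)⁻¹ = n * (z * w) * (n : G)⁻¹ := by
      intro z e w h
      calc _ = n * (e⁻¹ * (z * e)) * w * (n : G)⁻¹ := by group
        _ = _ := by rw [h]; group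
    -- `E` acts simply transitively on each fibre, by `(n, u, v) ↦ (ne⁻¹, eue⁻¹, eve⁻¹)`.
    let a : E → {q // F q = F (n, ⟨(u, v), huv⟩)} := fun e =>
      ⟨(n * ⟨(e : G)⁻¹, inv_mem e.2.1⟩, ⟨(e * u * e⁻¹, e * v * e⁻¹), (Commute.conj_iff e).mpr huv⟩),
        Subtype.ext (Prod.ext (hconj x e u (hEx e e.2)) (hconj y e v (hEy e e.2)))⟩
    refine (Nat.card_congr (Equiv.ofBijective a ⟨fun e e' h => ?_, ?_⟩)).symm
    · have h1 := congr_arg (fun q => q.1.1) h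
      have h2 := congr_arg Subtype.val (mul_left_cancel h1)
      exact Subtype.ext (inv_injective h2)
    · rintro ⟨⟨n', ⟨⟨u', v'⟩, huv'⟩⟩, hq⟩
      have hq' := congr_arg Subtype.val hq
      have hq1 : (n' : G) * (x * u') * (n' : G)⁻¹ = n * (x * u) * (n : G)⁻¹ :=
        congr_arg Prod.fst hq'
      have hq2 : (n' : G) * (y * v') * (n' : G)⁻¹ = n * (y * v) * (n : G)⁻¹ :=
        congr_arg Prod.snd hq'
      have hmove : ∀ z w w' : G, (n' : G) * (z * w') * (n' : G)⁻¹ = n * (z * w) * (n : G)⁻¹ →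
          ((n' : G)⁻¹ * n) * (z * w) * ((n' : G)⁻¹ * n)⁻¹ = z * w' := fun z w w' h => by
        calc _ = (n' : G)⁻¹ * (n * (z * w) * (n : G)⁻¹) * n' := by group
          _ = _ := by rw [← h]; group
      obtain ⟨hex, heu⟩ := conj_eq_and_conj_eq_of_conj_mul_eq (hrC' x hx) (hrN' _ u.2.1)
        (hrN' _ u'.2.1) (hEx _ u.2) (hEx _ u'.2) (hmove x u u' hq1)
      obtain ⟨hey, hev⟩ := conj_eq_and_conj_eq_of_conj_mul_eq (hrC' y hy) (hrN' _ v.2.1)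
        (hrN' _ v'.2.1) (hEy _ v.2) (hEy _ v'.2) (hmove y v v' hq2)
      have he : (n' : G)⁻¹ * n ∈ E := mem_inf.mpr ⟨mul_mem (inv_mem n'.2) n.2, mem_centralizer_pair_iff.mpr
        ⟨(mul_inv_eq_iff_eq_mul.mp hex).symm, (mul_inv_eq_iff_eq_mul.mp hey).symm⟩⟩
      refine ⟨⟨_, he⟩, Subtype.ext (Prod.ext (Subtype.ext ?_) (Subtype.ext
        (Prod.ext (Subtype.ext heu) (Subtype.ext hev))))⟩
      change (n : G) * ((n' : G)⁻¹ * n)⁻¹ = n'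
      group
  have hcount := Nat.card_eq_mul_card_of_card_fiber F _ hfib
  rw [Nat.card_prod, card_comm_eq_card_conjClasses_mul_card] at hcount
  have hpos : 0 < Nat.card E := Nat.card_pos
  refine (Nat.eq_of_mul_eq_mul_left hpos ?_).symm
  rw [← hcount, ccl]
  ring

/-- The class number of a coprime split extension by an abelian group. -/
theorem ccl_mul_card_of_isComplement' [N.Normal] [Fintype C] (hNC : IsComplement' N C)
    (hcop : (Nat.card C).Coprime (Nat.card N)) (hC : ∀ a ∈ C, ∀ b ∈ C, a * b = b * a) :
    ccl G * Nat.card C =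
      ∑ c : C × C, ccl (N ⊓ centralizer ({(c.1 : G), (c.2 : G)} : Set G) : Subgroup G) := by
  have hbij : Function.Bijective fun c : C => ((c : G) : G ⧸ N) := by
    refine (Nat.bijective_iff_injective_and_card _).mpr ⟨fun a b hab => ?_, ?_⟩
    · have h1 : (a : G)⁻¹ * b ∈ N ⊓ C := mem_inf.mpr ⟨QuotientGroup.eq.mp hab, mul_mem (inv_mem a.2) b.2⟩
      rw [hNC.disjoint.eq_bot, mem_bot, inv_mul_eq_one] at h1
      exact Subtype.ext h1
    · exact hNC.symm.index_eq_card.symm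
  let e := Equiv.ofBijective _ hbij
  let f : {p : G × G // Commute p.1 p.2} → C × C := fun p => (e.symm p.1.1, e.symm p.1.2)
  have hf : ∀ c : C × C, Nat.card {p // f p = c} =
      Nat.card N * ccl (N ⊓ centralizer ({(c.1 : G), (c.2 : G)} : Set G) : Subgroup G) := by
    intro c
    rw [← card_commute_coset hNC hcop hC c.1.2 c.2.2]
    refine Nat.card_congr ((Equiv.subtypeSubtypeEquivSubtypeInter _
      (fun p : G × G => (p.1 : G ⧸ N) = (c.1 : G) ∧ (p.2 : G ⧸ N) = (c.2 : G))).symm.trans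
      (Equiv.subtypeEquivRight fun p => ?_)).symm
    rw [Prod.ext_iff]
    exact and_congr (Equiv.symm_apply_eq e).symm (Equiv.symm_apply_eq e).symm
  have hsum := card_comm_eq_card_conjClasses_mul_card G
  rw [← Nat.card_congr (Equiv.sigmaFiberEquiv f), Nat.card_sigma,
    Finset.sum_congr rfl fun c _ => hf c, ← Finset.mul_sum, ← hNC.card_mul_card] at hsum
  have hpos : 0 < Nat.card N := Nat.card_pos
  refine Nat.eq_of_mul_eq_mul_left hpos ?_
  rw [hsum, ccl]
  ring

/-- The form needed for `PA₀` and `QB₀`: centralizers are taken in the ambient group. -/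
theorem ccl_sup_mul_card [Fintype C] (hn : ∀ c ∈ C, ∀ n ∈ N, c * n * c⁻¹ ∈ N)
    (hcop : (Nat.card C).Coprime (Nat.card N)) (hC : ∀ a ∈ C, ∀ b ∈ C, a * b = b * a) :
    ccl (C ⊔ N : Subgroup G) * Nat.card C =
      ∑ c : C × C, ccl (N ⊓ centralizer ({(c.1 : G), (c.2 : G)} : Set G) : Subgroup G) := by
  set X := C ⊔ N with hX
  have hNX : N ≤ X := le_sup_right
  have hCX : C ≤ X := le_sup_left
  have := normal_subgroupOf_sup_of_le_normalizer (le_normalizer_of_forall_conj_mem hn)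
  have hcN : Nat.card (N.subgroupOf X) = Nat.card N :=
    Nat.card_congr (subgroupOfEquivOfLe hNX).toEquiv
  have hcC : Nat.card (C.subgroupOf X) = Nat.card C :=
    Nat.card_congr (subgroupOfEquivOfLe hCX).toEquiv
  have hco : (Nat.card (C.subgroupOf X)).Coprime (Nat.card (N.subgroupOf X)) := by rwa [hcN, hcC]
  have hcompl : IsComplement' (N.subgroupOf X) (C.subgroupOf X) := by
    refine isComplement'_of_coprime ?_ hco.symm
    rw [hcN, hcC, hX, card_sup_of_coprime hn hcop, mul_comm]
  have := Fintype.ofFinite (C.subgroupOf X)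
  have key := ccl_mul_card_of_isComplement' hcompl hco
    (fun a ha b hb => Subtype.ext (hC a ha b hb))
  rw [hcC] at key
  rw [key]
  let e := (subgroupOfEquivOfLe hCX).toEquiv
  refine Fintype.sum_equiv (Equiv.prodCongr e e) _ _ fun c => ?_
  refine ccl_congr ((equivMapOfInjective _ X.subtype X.subtype_injective).trans
    (MulEquiv.subgroupCongr ?_))
  ext g
  simp only [mem_map, mem_inf, mem_centralizer_pair_iff]
  constructor
  · rintro ⟨g, ⟨h1, h2, h3⟩, rfl⟩
    exact ⟨h1, congr_arg Subtype.val h2, congr_arg Subtype.val h3⟩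
  · rintro ⟨h1, h2, h3⟩
    exact ⟨⟨g, hNX h1⟩, ⟨h1, Subtype.ext h2, Subtype.ext h3⟩, rfl⟩

end Count

/-! ### Commuting factors of coprime orders. -/

theorem exists_pow_mul_eq_left_of_coprime {G : Type*} [Group G] {m n : ℕ} (h : m.Coprime n) :
    ∃ r : ℕ, ∀ a b : G, a ^ m = 1 → b ^ n = 1 → Commute a b → (a * b) ^ r = a := by
  obtain ⟨r, hm, hn⟩ := Nat.chineseRemainder h 1 0
  refine ⟨r, fun a b ha hb hab => ?_⟩
  have h1 := pow_eq_pow_iff_modEq.mpr (hm.of_dvd (orderOf_dvd_of_pow_eq_one ha))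
  have h2 := pow_eq_pow_iff_modEq.mpr (hn.of_dvd (orderOf_dvd_of_pow_eq_one hb))
  rw [hab.mul_pow, h1, h2, pow_one, pow_zero, mul_one]

namespace Subgroup

variable {G : Type*} [Group G]

theorem pow_card_eq_one_of_mem {H : Subgroup G} {a : G} (ha : a ∈ H) : a ^ Nat.card H = 1 :=
  congr_arg Subtype.val (pow_card_eq_one' (x := (⟨a, ha⟩ : H)))

/-- By coprimality `x` is a power of `x * z`, so whatever commutes with the product commutes with
both factors. -/
theorem centralizer_pair_mul {P Q : Subgroup G} (hcop : (Nat.card P).Coprime (Nat.card Q))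
    (hPQ : P ≤ centralizer (Q : Set G)) {x y z w : G} (hx : x ∈ P) (hy : y ∈ P) (hz : z ∈ Q)
    (hw : w ∈ Q) : centralizer ({x * z, y * w} : Set G) =
      centralizer ({x, y} : Set G) ⊓ centralizer ({z, w} : Set G) := by
  obtain ⟨r, hr⟩ := exists_pow_mul_eq_left_of_coprime (G := G) hcop
  have key : ∀ a ∈ P, ∀ b ∈ Q, ∀ g : G,
      a * b * g = g * (a * b) ↔ a * g = g * a ∧ b * g = g * b := by
    intro a ha b hb g
    refine ⟨fun h => ?_, fun h => Commute.mul_left h.1 h.2⟩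
    have hab : Commute a b := (mem_centralizer_iff.mp (hPQ ha) b hb).symm
    have h1 : Commute a g := by
      rw [← hr a b (pow_card_eq_one_of_mem ha) (pow_card_eq_one_of_mem hb) hab]
      exact Commute.pow_left h r
    refine ⟨h1, ?_⟩
    have h2 := h1.inv_left.mul_left h
    rwa [inv_mul_cancel_left] at h2
  ext g
  rw [mem_inf, mem_centralizer_pair_iff, mem_centralizer_pair_iff, mem_centralizer_pair_iff,
    key x hx z hz, key y hy w hw]
  tauto

theorem card_mul_card_of_isPiNumber {π : Set Nat.Primes} {X A B : Subgroup G} (hA : A ≤ X)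
    (hB : B ≤ X) (hAπ : IsPiNumber π (Nat.card A)) (hAi : IsPiNumber πᶜ (A.relIndex X))
    (hBπ : IsPiNumber πᶜ (Nat.card B)) (hBi : IsPiNumber π (B.relIndex X)) :
    Nat.card A * Nat.card B = Nat.card X := by
  have h1 := card_mul_relIndex hA
  have h2 := card_mul_relIndex hB
  have h3 : Nat.card A ∣ B.relIndex X :=
    (hAπ.coprime hBπ).dvd_of_dvd_mul_left (h2 ▸ h1 ▸ Dvd.intro _ rfl)
  have h4 : B.relIndex X ∣ Nat.card A :=
    (hBi.coprime hAi).dvd_of_dvd_mul_right (h1 ▸ h2 ▸ Dvd.intro_left _ rfl)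
  rw [Nat.dvd_antisymm h3 h4, mul_comm, h2]

/-- An abstract isomorphism suffices: by coprimality it kills the second coordinate of `A` and the
first of `B`. -/
theorem commute_of_mulEquiv_prod {N A B : Subgroup G} (hA : A ≤ N) (hB : B ≤ N)
    (hcop : (Nat.card A).Coprime (Nat.card B))
    (φ : N ≃* A.subgroupOf N × B.subgroupOf N) : A ≤ centralizer (B : Set G) := by
  have hcA : Nat.card (A.subgroupOf N) = Nat.card A :=
    Nat.card_congr (subgroupOfEquivOfLe hA).toEquiv
  have hcB : Nat.card (B.subgroupOf N) = Nat.card B :=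
    Nat.card_congr (subgroupOfEquivOfLe hB).toEquiv
  have triv : ∀ {K : Type _} [Group K] (m n : ℕ), m.Coprime n → ∀ k : K, k ^ m = 1 → k ^ n = 1 →
      k = 1 := fun m n h k h1 h2 => orderOf_eq_one_iff.mp (Nat.Coprime.eq_one_of_dvd
        (Nat.Coprime.coprime_dvd_left (orderOf_dvd_of_pow_eq_one h1) h)
        (orderOf_dvd_of_pow_eq_one h2))
  intro a ha
  rw [mem_centralizer_iff]
  intro b hb
  have h1 : (φ ⟨a, hA ha⟩).2 = 1 := by
    refine triv _ _ hcop _ ?_ ?_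
    · rw [← Prod.pow_snd, ← map_pow,
        show (⟨a, hA ha⟩ : N) ^ Nat.card A = 1 from Subtype.ext (pow_card_eq_one_of_mem ha),
        map_one, Prod.snd_one]
    · rw [← hcB]; exact pow_card_eq_one'
  have h2 : (φ ⟨b, hB hb⟩).1 = 1 := by
    refine triv _ _ hcop _ ?_ ?_
    · rw [← hcA]; exact pow_card_eq_one'
    · rw [← Prod.pow_fst, ← map_pow,
        show (⟨b, hB hb⟩ : N) ^ Nat.card B = 1 from Subtype.ext (pow_card_eq_one_of_mem hb),
        map_one, Prod.fst_one]
  have h3 : (⟨b, hB hb⟩ : N) * ⟨a, hA ha⟩ = ⟨a, hA ha⟩ * ⟨b, hB hb⟩ := by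
    apply φ.injective
    rw [map_mul, map_mul]
    refine Prod.ext ?_ ?_
    · rw [Prod.fst_mul, Prod.fst_mul, h2, one_mul, mul_one]
    · rw [Prod.snd_mul, Prod.snd_mul, h1, one_mul, mul_one]
  exact congr_arg Subtype.val h3

/-- A finite group is the direct product of two commuting subgroups of coprime orders whose product
is the order of the group. -/
theorem nonempty_mulEquiv_prod [Finite G] {A B : Subgroup G} (hAB : A ≤ centralizer (B : Set G))
    (hcop : (Nat.card A).Coprime (Nat.card B)) (hcard : Nat.card A * Nat.card B = Nat.card G) :
    Nonempty (G ≃* A × B) := by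
  have hcomm : ∀ (a : A) (b : B), Commute (A.subtype a) (B.subtype b) := fun a b =>
    (mem_centralizer_iff.mp (hAB a.2) b b.2).symm
  exact ⟨(MulEquiv.ofBijective (MonoidHom.noncommCoprod A.subtype B.subtype hcomm)
    (isComplement'_of_coprime hcard hcop)).symm⟩

end Subgroup

/-! ### Hall subgroups of the extension and class numbers of fixed points. -/

section

variable {G : Type*} [Group G] {π : Set Nat.Primes}

theorem ccl_le_of_isCon {X A B : Subgroup G} (hX : IsCon π X) (hA : A ≤ X) (hB : B ≤ X)
    (hAπ : IsPiNumber π (Nat.card A)) (hAi : IsPiNumber πᶜ (A.relIndex X))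
    (hBπ : IsPiNumber πᶜ (Nat.card B)) (hBi : IsPiNumber πᶜᶜ (B.relIndex X)) :
    ccl X ≤ ccl A * ccl B := by
  have hA' := subgroupOfEquivOfLe hA
  have hB' := subgroupOfEquivOfLe hB
  rw [← ccl_congr hA', ← ccl_congr hB']
  exact hX _ _ ⟨by rwa [Nat.card_congr hA'.toEquiv], hAi⟩ ⟨by rwa [Nat.card_congr hB'.toEquiv], hBi⟩

theorem centralizer_pair_one : centralizer ({1, 1} : Set G) = ⊤ := by
  ext g
  simp only [mem_centralizer_pair_iff, one_mul, mul_one, and_self, mem_top]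

theorem IsPiNumber.sup_isHallSubgroup [Finite G] {N C A P : Subgroup G} (hNC : IsComplement' N C)
    (hcop : (Nat.card C).Coprime (Nat.card N)) (hA : A ≤ N) (hP : P ≤ C)
    (hPA : ∀ c ∈ P, ∀ a ∈ A, c * a * c⁻¹ ∈ A)
    (hAπ : IsPiNumber π (Nat.card A)) (hAi : IsPiNumber πᶜ (A.relIndex N))
    (hPπ : IsPiNumber π (Nat.card P)) (hPi : IsPiNumber πᶜ (P.relIndex C)) :
    IsHallSubgroup π (P ⊔ A) := by
  have hcard := card_sup_of_coprime hPA ((hcop.coprime_dvd_left (card_dvd_of_le hP)).coprime_dvd_right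
    (card_dvd_of_le hA))
  refine ⟨by rw [hcard]; exact hPπ.mul hAπ, ?_⟩
  have h1 := (P ⊔ A).card_mul_index
  rw [hcard, ← hNC.card_mul_card, ← card_mul_relIndex hA, ← card_mul_relIndex hP] at h1
  have h2 : 0 < Nat.card P * Nat.card A := Nat.mul_pos Nat.card_pos Nat.card_pos
  have h3 : (P ⊔ A).index = A.relIndex N * P.relIndex C := by
    refine Nat.eq_of_mul_eq_mul_left h2 (h1.trans ?_)
    ring
  rw [h3]
  exact hAi.mul hPi

variable [Finite G] [Group.IsSolvable G]

theorem IsHallSubgroup.nonempty_mulEquiv {A B : Subgroup G} (hA : IsHallSubgroup π A)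
    (hB : IsHallSubgroup π B) : Nonempty (A ≃* B) := by
  have key : ∀ A B : Subgroup G, IsHallSubgroup π A → IsHallSubgroup π B →
      ∃ g, A.map (MulAut.conj g).toMonoidHom ≤ B := fun A B hA hB => by
    obtain ⟨g, hg⟩ := (exists_isHallSubgroup_and_dominates π _ G rfl).2 B A hB hA.1
    refine ⟨g, ?_⟩
    rintro _ ⟨a, ha, rfl⟩
    exact hg a ha
  have hcard (A : Subgroup G) (g : G) : Nat.card (A.map (MulAut.conj g).toMonoidHom) = Nat.card A :=
    card_map_of_injective (MulAut.conj g).injective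
  obtain ⟨g, hg⟩ := key A B hA hB
  obtain ⟨h, hh⟩ := key B A hB hA
  have hle := card_le_of_le hh
  rw [hcard] at hle
  have heq : A.map (MulAut.conj g).toMonoidHom = B :=
    eq_of_le_of_card_ge hg (by rwa [hcard])
  exact ⟨(A.equivMapOfInjective _ (MulAut.conj g).injective).trans (MulEquiv.subgroupCongr heq)⟩

/-- Adding commuting coprime operators does not increase the class number of the fixed points. -/
theorem ccl_inf_inf_centralizer_pair_le {A C : Subgroup G}
    (hCA : ∀ c ∈ C, ∀ a ∈ A, c * a * c⁻¹ ∈ A) (hcop : (Nat.card C).Coprime (Nat.card A))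
    (hC : ∀ a ∈ C, ∀ b ∈ C, a * b = b * a) {x y z w : G} (hx : x ∈ C) (hy : y ∈ C) (hz : z ∈ C)
    (hw : w ∈ C) :
    ccl (A ⊓ (centralizer ({x, y} : Set G) ⊓ centralizer ({z, w} : Set G)) : Subgroup G) ≤
      ccl (A ⊓ centralizer ({x, y} : Set G) : Subgroup G) := by
  have hle : closure ({z, w} : Set G) ≤ C := (closure_le C).mpr (Set.pair_subset hz hw)
  rw [← inf_assoc, ← centralizer_closure ({z, w} : Set G)]
  refine ccl_inf_centralizer_le (fun d hd k hk => ?_)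
    ((hcop.coprime_dvd_left (card_dvd_of_le hle)).coprime_dvd_right (card_dvd_of_le inf_le_left))
  have hd' := hle hd
  refine mem_inf.mpr ⟨hCA d hd' k hk.1, ?_⟩
  have hdZ : d ∈ centralizer ({x, y} : Set G) :=
    mem_centralizer_pair_iff.mpr ⟨hC x hx d hd', hC y hy d hd'⟩
  exact mul_mem (mul_mem hdZ hk.2) (inv_mem hdZ)

theorem le_centralizer_pair_of_ccl_eq {A C : Subgroup G}
    (hCA : ∀ c ∈ C, ∀ a ∈ A, c * a * c⁻¹ ∈ A) (hcop : (Nat.card C).Coprime (Nat.card A))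
    {z w : G} (hz : z ∈ C) (hw : w ∈ C)
    (h : ccl (A ⊓ centralizer ({z, w} : Set G) : Subgroup G) = ccl A) :
    A ≤ centralizer ({z, w} : Set G) := by
  have hle : closure ({z, w} : Set G) ≤ C := (closure_le C).mpr (Set.pair_subset hz hw)
  rw [← centralizer_closure] at h ⊢
  exact le_centralizer_of_ccl_eq (fun d hd => hCA d (hle hd))
    (hcop.coprime_dvd_left (card_dvd_of_le hle)) h

end

/-! ### The main theorem. -/

theorem theoremB (π : Set Nat.Primes) {G : Type*} [Group G] [Finite G] [Group.IsSolvable G]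
    (N : Subgroup G) [N.Normal] (hcyc : IsCyclic (G ⧸ N))
    (hcop : Nat.Coprime (Nat.card N) (Nat.card (G ⧸ N)))
    (hsub : ∀ H : Subgroup G, H ≤ N → IsCon π H) :
    IsCon π G ∧ (IsConStar π N → IsConStar π G) := by
  classical
  obtain ⟨C, hNC⟩ := exists_right_complement'_of_coprime (N := N) hcop
  have hCN : (Nat.card C).Coprime (Nat.card N) := by
    rw [← hNC.symm.index_eq_card]; exact hcop.symm
  have hC : ∀ a ∈ C, ∀ b ∈ C, a * b = b * a := by
    intro a ha b hb
    have hcomm := hcyc.isMulCommutative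
    have := mul_comm' (a : G ⧸ N) b
    rw [← QuotientGroup.mk_mul, ← QuotientGroup.mk_mul, QuotientGroup.eq] at this
    have h1 : (a * b)⁻¹ * (b * a) ∈ N ⊓ C :=
      mem_inf.mpr ⟨this, mul_mem (inv_mem (mul_mem ha hb)) (mul_mem hb ha)⟩
    rw [hNC.disjoint.eq_bot, mem_bot, inv_mul_eq_one] at h1
    exact h1
  obtain ⟨P, hPC, hPπ, hPi⟩ := exists_le_isPiNumber_relIndex π C
  obtain ⟨Q, hQC, hQπ, hQi⟩ := exists_le_isPiNumber_relIndex πᶜ C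
  obtain ⟨A₀, hAN, hAπ, hAi, hCA⟩ := exists_invariant_isPiNumber_relIndex π (N := N) hCN
  obtain ⟨B₀, hBN, hBπ, hBi, hCB⟩ := exists_invariant_isPiNumber_relIndex πᶜ (N := N) hCN
  have hPQcop := hPπ.coprime hQπ
  have hPQcard : Nat.card P * Nat.card Q = Nat.card C :=
    card_mul_card_of_isPiNumber hPC hQC hPπ hPi hQπ (by rwa [compl_compl] at hQi)
  have hPQ : P ≤ centralizer (Q : Set G) := fun x hx =>
    mem_centralizer_iff.mpr fun z hz => hC z (hQC hz) x (hPC hx)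
  have hCA' : (Nat.card C).Coprime (Nat.card A₀) := hCN.coprime_dvd_right (card_dvd_of_le hAN)
  have hCB' : (Nat.card C).Coprime (Nat.card B₀) := hCN.coprime_dvd_right (card_dvd_of_le hBN)
  have hA₁ : IsHallSubgroup π (P ⊔ A₀) := IsPiNumber.sup_isHallSubgroup hNC hCN hAN hPC
    (fun c hc => hCA c (hPC hc)) hAπ hAi hPπ hPi
  have hB₁ : IsHallSubgroup πᶜ (Q ⊔ B₀) := IsPiNumber.sup_isHallSubgroup hNC hCN hBN hQC
    (fun c hc => hCB c (hQC hc)) hBπ hBi hQπ hQi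
  have hsplit : ∀ x ∈ P, ∀ y ∈ P, ∀ z ∈ Q, ∀ w ∈ Q, centralizer ({x * z, y * w} : Set G) =
      centralizer ({x, y} : Set G) ⊓ centralizer ({z, w} : Set G) :=
    fun x hx y hy z hz w hw => centralizer_pair_mul hPQcop hPQ hx hy hz hw
  have hcon : ∀ x ∈ C, ∀ y ∈ C, ccl (N ⊓ centralizer ({x, y} : Set G) : Subgroup G) ≤
      ccl (A₀ ⊓ centralizer ({x, y} : Set G) : Subgroup G) *
        ccl (B₀ ⊓ centralizer ({x, y} : Set G) : Subgroup G) := by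
    intro x hx y hy
    have hle : closure ({x, y} : Set G) ≤ C := (closure_le C).mpr (Set.pair_subset hx hy)
    have hco := hCN.coprime_dvd_left (card_dvd_of_le hle)
    rw [← centralizer_closure]
    have hN : ∀ d ∈ closure ({x, y} : Set G), ∀ n ∈ N, d * n * d⁻¹ ∈ N :=
      fun d _ n hn => ‹N.Normal›.conj_mem n hn d
    exact ccl_le_of_isCon (hsub _ inf_le_left) (inf_le_inf_right _ hAN) (inf_le_inf_right _ hBN)
      (hAπ.of_dvd (card_dvd_of_le inf_le_left))
      (isPiNumber_relIndex_inf_centralizer hAN hN (fun d hd => hCA d (hle hd)) hco hAπ hAi)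
      (hBπ.of_dvd (card_dvd_of_le inf_le_left))
      (isPiNumber_relIndex_inf_centralizer hBN hN (fun d hd => hCB d (hle hd)) hco hBπ hBi)
  -- Dropping the `Q`-parts `z, w` leaves a bound depending on `P` alone; `hfixB` is symmetric.
  have hfixA : ∀ x ∈ P, ∀ y ∈ P, ∀ z ∈ Q, ∀ w ∈ Q,
      ccl (A₀ ⊓ centralizer ({x * z, y * w} : Set G) : Subgroup G) ≤
        ccl (A₀ ⊓ centralizer ({x, y} : Set G) : Subgroup G) := fun x hx y hy z hz w hw => by
    rw [hsplit x hx y hy z hz w hw]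
    exact ccl_inf_inf_centralizer_pair_le hCA hCA' hC (hPC hx) (hPC hy) (hQC hz) (hQC hw)
  have hfixB : ∀ x ∈ P, ∀ y ∈ P, ∀ z ∈ Q, ∀ w ∈ Q,
      ccl (B₀ ⊓ centralizer ({x * z, y * w} : Set G) : Subgroup G) ≤
        ccl (B₀ ⊓ centralizer ({z, w} : Set G) : Subgroup G) := fun x hx y hy z hz w hw => by
    rw [hsplit x hx y hy z hz w hw, inf_comm (centralizer {x, y})]
    exact ccl_inf_inf_centralizer_pair_le hCB hCB' hC (hQC hz) (hQC hw) (hPC hx) (hPC hy)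
  let t : (P × P) × (Q × Q) → ℕ := fun c =>
    ccl (N ⊓ centralizer ({(c.1.1 * c.2.1 : G), (c.1.2 * c.2.2 : G)} : Set G) : Subgroup G)
  let f : P × P → ℕ := fun c => ccl (A₀ ⊓ centralizer ({(c.1 : G), (c.2 : G)} : Set G) : Subgroup G)
  let h : Q × Q → ℕ := fun c => ccl (B₀ ⊓ centralizer ({(c.1 : G), (c.2 : G)} : Set G) : Subgroup G)
  have hterm : ∀ c, t c ≤ f c.1 * h c.2 := fun c =>
    (hcon _ (mul_mem (hPC c.1.1.2) (hQC c.2.1.2)) _ (mul_mem (hPC c.1.2.2) (hQC c.2.2.2))).trans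
      (Nat.mul_le_mul (hfixA _ c.1.1.2 _ c.1.2.2 _ c.2.1.2 _ c.2.2.2)
        (hfixB _ c.1.1.2 _ c.1.2.2 _ c.2.1.2 _ c.2.2.2))
  have := Fintype.ofFinite C
  have := Fintype.ofFinite P
  have := Fintype.ofFinite Q
  have hsumA : ccl (P ⊔ A₀ : Subgroup G) * Nat.card P = ∑ c, f c :=
    ccl_sup_mul_card (fun c hc => hCA c (hPC hc)) (hCA'.coprime_dvd_left (card_dvd_of_le hPC))
      fun a ha b hb => hC a (hPC ha) b (hPC hb)
  have hsumB : ccl (Q ⊔ B₀ : Subgroup G) * Nat.card Q = ∑ c, h c :=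
    ccl_sup_mul_card (fun c hc => hCB c (hQC hc)) (hCB'.coprime_dvd_left (card_dvd_of_le hQC))
      fun a ha b hb => hC a (hQC ha) b (hQC hb)
  have hmulbij : Function.Bijective fun c : P × Q =>
      (⟨c.1 * c.2, mul_mem (hPC c.1.2) (hQC c.2.2)⟩ : C) := by
    refine (Nat.bijective_iff_injective_and_card _).mpr ⟨fun a b hab => ?_, ?_⟩
    · exact mul_injective_of_disjoint (disjoint_of_coprime_natCard hPQcop)
        (congr_arg Subtype.val hab)
    · rw [Nat.card_prod, hPQcard]
  have hsumG : ccl G * Nat.card C = ∑ c, t c := by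
    rw [ccl_mul_card_of_isComplement' hNC hCN hC]
    let e := Equiv.ofBijective _ hmulbij
    exact (Fintype.sum_equiv ((Equiv.prodProdProdComm P P Q Q).trans (Equiv.prodCongr e e)) t _
      fun c => rfl).symm
  have hsumAB : ∑ c : (P × P) × (Q × Q), f c.1 * h c.2 = (∑ c, f c) * ∑ c, h c := by
    rw [Fintype.sum_prod_type, Finset.sum_mul_sum]
  have hCpos : 0 < Nat.card C := Nat.card_pos
  have hprod : (∑ c, f c) * ∑ c, h c =
      ccl (P ⊔ A₀ : Subgroup G) * ccl (Q ⊔ B₀ : Subgroup G) * Nat.card C := by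
    rw [← hsumA, ← hsumB, ← hPQcard]
    ring
  have hmain : ccl G ≤ ccl (P ⊔ A₀ : Subgroup G) * ccl (Q ⊔ B₀ : Subgroup G) := by
    refine Nat.le_of_mul_le_mul_right ?_ hCpos
    rw [hsumG, ← hprod, ← hsumAB]
    exact Finset.sum_le_sum fun c _ => hterm c
  refine ⟨fun A B hA hB => ?_, fun hstar A B hA hB => ?_⟩
  -- Arbitrary Hall subgroups are isomorphic to the chosen `PA₀` and `QB₀`.
  · obtain ⟨eA⟩ := hA.nonempty_mulEquiv hA₁
    obtain ⟨eB⟩ := hB.nonempty_mulEquiv hB₁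
    rwa [ccl_congr eA, ccl_congr eB]
  obtain ⟨eA⟩ := hA.nonempty_mulEquiv hA₁
  obtain ⟨eB⟩ := hB.nonempty_mulEquiv hB₁
  rw [ccl_congr eA, ccl_congr eB]
  rcases hmain.lt_or_eq with hlt | heq
  · exact Or.inl hlt
  refine Or.inr ?_
  have hteq : ∀ c, t c = f c.1 * h c.2 := by
    have h1 : ∑ c, t c = ∑ c : (P × P) × (Q × Q), f c.1 * h c.2 := by
      rw [← hsumG, hsumAB, hprod, heq]
    exact fun c => (Finset.sum_eq_sum_iff_of_le fun c _ => hterm c).mp h1 c (Finset.mem_univ c)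
  have hN : ccl N = ccl A₀ * ccl B₀ := by
    have h1 : ccl (N ⊓ centralizer {(1 * 1 : G), 1 * 1} : Subgroup G) =
        ccl (A₀ ⊓ centralizer {(1 : G), 1} : Subgroup G) *
          ccl (B₀ ⊓ centralizer {(1 : G), 1} : Subgroup G) := hteq ((1, 1), (1, 1))
    rwa [mul_one, centralizer_pair_one, inf_top_eq, inf_top_eq, inf_top_eq] at h1
  have hA₀N := subgroupOfEquivOfLe hAN
  have hB₀N := subgroupOfEquivOfLe hBN
  have hAB₀ : A₀ ≤ centralizer (B₀ : Set G) := by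
    have h1 := hstar (A₀.subgroupOf N) (B₀.subgroupOf N)
      ⟨by rwa [Nat.card_congr hA₀N.toEquiv], hAi⟩ ⟨by rwa [Nat.card_congr hB₀N.toEquiv], hBi⟩
    rw [ccl_congr hA₀N, ccl_congr hB₀N, hN] at h1
    obtain ⟨φ⟩ := h1.resolve_left (lt_irrefl _)
    exact commute_of_mulEquiv_prod hAN hBN (hAπ.coprime hBπ) φ
  -- Equality of the outer terms of `s ≤ ab ≤ uv` with positive `u, v` forces equality in each
  -- factor.
  have hsqueeze : ∀ a b u v s : ℕ, s ≤ a * b → a ≤ u → b ≤ v → s = u * v → 0 < u → 0 < v →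
      a = u ∧ b = v := by
    intro a b u v s hs ha hb hsuv hu hv
    constructor
    · by_contra hne
      have : a < u := lt_of_le_of_ne ha hne
      nlinarith
    · by_contra hne
      have : b < v := lt_of_le_of_ne hb hne
      nlinarith
  -- The term with trivial `P`-parts and repeated `Q`-part `z` yields `ccl (C_{A₀}(z)) = ccl A₀`.
  have hQA : Q ≤ centralizer (A₀ : Set G) := by
    intro z hz
    have h1 := (hsqueeze _ _ _ _ _
      (hcon _ (mul_mem (one_mem C) (hQC hz)) _ (mul_mem (one_mem C) (hQC hz)))
      (hfixA 1 (one_mem P) 1 (one_mem P) z hz z hz) (hfixB 1 (one_mem P) 1 (one_mem P) z hz z hz)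
      (hteq ((1, 1), (⟨z, hz⟩, ⟨z, hz⟩))) (ccl_pos _) (ccl_pos _)).1
    rw [centralizer_pair_one, inf_top_eq, one_mul] at h1
    have h2 := le_centralizer_pair_of_ccl_eq hCA hCA' (hQC hz) (hQC hz) h1
    exact mem_centralizer_iff.mpr fun a ha => (mem_centralizer_pair_iff.mp (h2 ha)).1.symm
  have hPB : P ≤ centralizer (B₀ : Set G) := by
    intro x hx
    have h1 := (hsqueeze _ _ _ _ _
      (hcon _ (mul_mem (hPC hx) (one_mem C)) _ (mul_mem (hPC hx) (one_mem C)))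
      (hfixA x hx x hx 1 (one_mem Q) 1 (one_mem Q)) (hfixB x hx x hx 1 (one_mem Q) 1 (one_mem Q))
      (hteq ((⟨x, hx⟩, ⟨x, hx⟩), (1, 1))) (ccl_pos _) (ccl_pos _)).2
    rw [centralizer_pair_one, inf_top_eq, mul_one] at h1
    have h2 := le_centralizer_pair_of_ccl_eq hCB hCB' (hPC hx) (hPC hx) h1
    exact mem_centralizer_iff.mpr fun a ha => (mem_centralizer_pair_iff.mp (h2 ha)).1.symm
  have hcomm : P ⊔ A₀ ≤ centralizer ((Q ⊔ B₀ : Subgroup G) : Set G) :=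
    sup_le
      (le_centralizer_iff.mp (sup_le (le_centralizer_iff.mp hPQ) (le_centralizer_iff.mp hPB)))
      (le_centralizer_iff.mp (sup_le hQA (le_centralizer_iff.mp hAB₀)))
  have hcard : Nat.card (P ⊔ A₀ : Subgroup G) * Nat.card (Q ⊔ B₀ : Subgroup G) = Nat.card G := by
    rw [← card_top (G := G)]
    refine card_mul_card_of_isPiNumber (π := π) le_top le_top hA₁.1 ?_ hB₁.1 ?_
    · rw [relIndex_top_right]; exact hA₁.2
    · rw [relIndex_top_right]; have := hB₁.2; rwa [compl_compl] at this
  obtain ⟨e⟩ := nonempty_mulEquiv_prod hcomm (hA₁.1.coprime hB₁.1) hcard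
  exact ⟨e.trans (MulEquiv.prodCongr eA.symm eB.symm)⟩
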